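/- **Theorem.** Let $D$ be an oriented virtual link diagram with $n$ classical crossings. Its Kauffman bracket is $$[D]=\sum_{S}A^{a(S)}B^{b(S)}d^{\,c(S)-1}\in\mathbb Z[A,B,d],$$ where $S$ runs over the $2^n$ Kauffman states of $D$ (choices of the $A$ or the $B$ smoothing at each classical crossing), and $a(S)$, $b(S)$, $c(S)$ are the numbers of $A$ smoothings, $B$ smoothings and closed curves of $S$. Let $U$ be the universe graph of $D$: the abstract 4-regular graph whose vertices are the classical crossings and whose edges are the arcs of $D$ between classical crossings (passing straight through virtual crossings), together with one free loop for each link component without classical crossings; let $c(U)$ be the number of its connected components, each free loop counting as one. Let $C$ be any (undirected) Euler system of $U$, i.e. a set that contains one Euler circuit for each connected component of $U$ with vertices. A transition at a vertex $v$ is a pairing of the four half-edges at $v$. Of the two transitions at $v$ that $C$ does not follow, exactly one is *consistent with $C$*, i.e. pairs incoming with outgoing half-edges for an orientation of the circuit of $C$ at $v$. The mark of $v$ is given by: (unmarked) if $C$ follows the link at $v$ and the oriented smoothing is consistent with $C$; $r$ if $C$ follows the link and the unoriented smoothing is consistent with $C$; $c$ (resp. $cr$) if $C$ follows the oriented (resp.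 unoriented) smoothing and the link's own transition is consistent with $C$; $u$ if $C$ follows the unoriented smoothing and the oriented smoothing is consistent with $C$; $ur$ if $C$ follows the oriented smoothing and the unoriented smoothing is consistent with $C$. (The oriented smoothing is the one that respects the link's orientation.) The marked interlacement graph $G=\mathcal L(D,C)$ has the classical crossings as its vertices, with these marks; a vertex is looped if and only if the crossing is negative; distinct vertices $v,w$ are adjacent if and only if they are interlaced with respect to $C$ (a circuit of $C$ meets them in the cyclic order $v,w,v,w$); and $G$ has $\phi=c(U)-1$ free loops. For a marked graph $G$ with $n$ vertices and $\phi$ free loops, let $\mathcal A(G)$ be its adjacency matrix over $GF(2)$, with diagonal entry $1$ at looped vertices. For $T\subseteq V(G)$ let $\Delta_T$ be the diagonal matrix over $GF(2)$ whose entry at $v\in T$ is $1$ iff the mark of $v$ has no $r$, and whose entry at $v\notin T$ is $1$ iff the mark of $v$ has an $r$. Let $\mathcal A(G)_T$ be obtained from $\mathcal A(G)+\Delta_T$ by removing the row and column of every vertex that is marked $c$ or $cr$ and has diagonal entry $0$, or is marked $u$ or $ur$ and has diagonal entry $1$. The marked-graph bracket is $$[G]=d^{\phi}\sum_{T\subseteq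 V(G)}A^{n-|T|}B^{|T|}d^{\nu(\mathcal A(G)_T)},$$ where $\nu$ denotes the $GF(2)$-nullity. Then $$[\mathcal L(D,C)]=[D].$$ (For the empty diagram, the exponents $c(S)-1$ and $c(U)-1$ are read as $0$.) -/

import Mathlib

open scoped Classical

/-! ### 4-regular graphs, circuit partitions, Euler systems -/

/-- A finite 4-regular multigraph (loops and parallel edges allowed) in terms of half-edges,
together with a number of free loops: `vert h` is the vertex on which the half-edge `h` is
incident and `mate h` is the other half of its edge. -/
structure FourRegularGraph (V H : Type*) where
  vert : H → V
  mate : H → H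
  mate_mate : ∀ h, mate (mate h) = h
  mate_ne : ∀ h, mate h ≠ h
  card_vert : ∀ v, Nat.card {h : H // vert h = v} = 4
  freeLoops : ℕ

namespace FourRegularGraph

variable {V H : Type*} (G : FourRegularGraph V H)

/-- The connected components that contain vertices. -/
def Component : Type _ := Quot fun v w : V => ∃ h, G.vert h = v ∧ G.vert (G.mate h) = w

/-- `c(G)`: the number of connected components; each free loop counts as a component. -/
noncomputable def numComponents : ℕ := Nat.card G.Component + G.freeLoops

/-- A partition of the edges into circuits, given by a transition (a pairing of the four
incident half-edges) at every vertex: a circuit that arrives along `h` leaves along `tr h`. -/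
structure CircuitPartition where
  tr : H → H
  vert_tr : ∀ h, G.vert (tr h) = G.vert h
  tr_tr : ∀ h, tr (tr h) = h
  tr_ne : ∀ h, tr h ≠ h

/-- The (undirected) circuits of a circuit partition, as classes of half-edges. Free loops are not
included. -/
def CircuitPartition.Circuit {G : FourRegularGraph V H} (P : G.CircuitPartition) : Type _ :=
  Quot fun h h' : H => h' = G.mate h ∨ h' = P.tr h

/-- An undirected Euler system: a circuit partition that has just one circuit in each connected
component, that is, half-edges in the same component are in the same circuit. -/
structure EulerSystem extends CircuitPartition G where
  euler : ∀ h h' : H,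
    (Quot.mk _ (G.vert h) : G.Component) = Quot.mk _ (G.vert h') →
      (Quot.mk _ h : toCircuitPartition.Circuit) = Quot.mk _ h'

namespace EulerSystem

variable {G} (C : G.EulerSystem)

/-- Following an Euler circuit: leave a vertex along the half-edge `h`, traverse the edge,
arrive along `mate h`, and leave the next vertex along `step h`. -/
def step (h : H) : H := C.tr (G.mate h)

/-- The half-edges `h` and `h'` are in the same circuit of `C`, and an orientation of the circuit
that leaves along `h` also leaves along `h'`. (This does not depend on a choice of orientations:
reversing the circuit, it arrives along both.) -/
def SameDirection (h h' : H) : Prop := ∃ k : ℕ, C.step^[k] h = h'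

/-- Following the circuit of `C` once around from some half-edge at `v`, we meet `v`, then `w`,
then `v`, then `w`. -/
def Interlaced (v w : V) : Prop :=
  ∃ (h : H) (i j k : ℕ), i < j ∧ j < k ∧ k < Function.minimalPeriod C.step h ∧
    G.vert h = v ∧ G.vert (C.step^[i] h) = w ∧
    G.vert (C.step^[j] h) = v ∧ G.vert (C.step^[k] h) = w

/-- The interlacement graph (without loops). -/
def interlacement : SimpleGraph V := SimpleGraph.fromRel C.Interlaced

end EulerSystem

end FourRegularGraph

/-! ### Marked graphs and their bracket -/

/-- The letter in a vertex mark, apart from `r`. -/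
inductive MarkLetter
  | none
  | c
  | u

/-- The six vertex marks: (unmarked), `r`, `c`, `cr`, `u`, `ur`. -/
structure VertexMark where
  letter : MarkLetter
  hasR : Bool

/-- A multiply marked graph, with loops and free loops. -/
structure MarkedGraph (V : Type*) where
  graph : SimpleGraph V
  looped : V → Prop
  mark : V → VertexMark
  freeLoops : ℕ

namespace Bracket

/-- The polynomials in three variables `A`, `B`, `d`. -/
abbrev Poly : Type := MvPolynomial (Fin 3) ℤ

noncomputable def A : Poly := MvPolynomial.X 0

noncomputable def B : Poly := MvPolynomial.X 1

noncomputable def d : Poly := MvPolynomial.X 2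

end Bracket

namespace MarkedGraph

variable {V : Type*} (G : MarkedGraph V)

/-- The Boolean adjacency matrix. -/
noncomputable def adjMatrix : Matrix V V (ZMod 2) := fun i j =>
  if i = j then (if G.looped i then 1 else 0) else (if G.graph.Adj i j then 1 else 0)

/-- The diagonal matrix `Δ_T`: for `i ∈ T` the entry is `1` if and only if the mark has no `r`;
for `i ∉ T` the entry is `1` if and only if the mark has an `r`. -/
noncomputable def deltaMatrix (T : Finset V) : Matrix V V (ZMod 2) :=
  Matrix.diagonal fun i =>
    if i ∈ T then (if (G.mark i).hasR then 0 else 1) else (if (G.mark i).hasR then 1 else 0)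

/-- The rows and columns that are removed from `𝒜(G) + Δ_T`. -/
def Removed (T : Finset V) (i : V) : Prop :=
  match (G.mark i).letter with
  | MarkLetter.none => False
  | MarkLetter.c => (G.adjMatrix + G.deltaMatrix T) i i = 0
  | MarkLetter.u => (G.adjMatrix + G.deltaMatrix T) i i = 1

/-- The matrix `𝒜(G)_T`. -/
noncomputable def adjMatrixT (T : Finset V) :
    Matrix {i : V // ¬ G.Removed T i} {i : V // ¬ G.Removed T i} (ZMod 2) :=
  (G.adjMatrix + G.deltaMatrix T).submatrix Subtype.val Subtype.val

/-- The `GF(2)`-nullity of `𝒜(G)_T`. -/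
noncomputable def nullity [Fintype V] (T : Finset V) : ℕ :=
  Module.finrank (ZMod 2) (LinearMap.ker (G.adjMatrixT T).mulVecLin)

/-- The marked-graph bracket polynomial. -/
noncomputable def bracket [Fintype V] : Bracket.Poly :=
  Bracket.d ^ G.freeLoops *
    ∑ T : Finset V,
      Bracket.A ^ (Fintype.card V - T.card) * Bracket.B ^ T.card * Bracket.d ^ G.nullity T

end MarkedGraph

/-! ### Virtual link diagrams -/

/-- An oriented virtual link diagram with classical crossings `X` and virtual crossings `Y`, in the
manner of a planar diagram code. A crossing has four ends, labelled `0, 1, 2, 3`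
counterclockwise, so `p` and `p + 2` are the two ends of one strand through the crossing.
At a classical crossing the under-strand enters at the end `0` and exits at the end `2`, and the
over-strand occupies the ends `1` and `3`. The involution `arc` tells which ends are connected
by the arcs of the diagram outside the crossings, `out` tells whether the orientation of the link
leaves the crossing at an end, and `freeCircles` is the number of link components without any
crossing at all. Planarity of the code is not required, so diagrams drawn in the plane are
included, and the results also hold for the others. -/
structure VirtualLinkDiagram (X Y : Type*) where
  arc : (X ⊕ Y) × Fin 4 → (X ⊕ Y) × Fin 4
  arc_arc : ∀ e, arc (arc e) = e
  out : (X ⊕ Y) × Fin 4 → Bool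
  out_arc : ∀ e, out (arc e) = !out e
  out_opposite : ∀ z p, out (z, p + 2) = !out (z, p)
  out_under : ∀ x, out (Sum.inl x, 0) = false
  freeCircles : ℕ

namespace VirtualLinkDiagram

variable {X Y : Type*} (D : VirtualLinkDiagram X Y)

/-- The crossing is positive: the over-strand runs from the end `3` to the end `1` (so that
turning its direction counterclockwise by a right angle gives the direction of the under-strand). -/
def Positive (x : X) : Prop := D.out (Sum.inl x, 1) = true

/-- The components of the link, as classes of ends; link components without any crossing are
not included. -/
def LinkComponent : Type _ :=
  Quot fun e e' : (X ⊕ Y) × Fin 4 => e' = D.arc e ∨ e' = (e.1, e.2 + 2)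

/-! #### The universe graph -/

/-- Passing straight through virtual crossings, and stopping at classical ones. -/
def through (e : (X ⊕ Y) × Fin 4) : (X ⊕ Y) × Fin 4 :=
  if e.1.isLeft then e else (e.1, e.2 + 2)

/-- Arriving at the end `e`: pass through if the crossing is virtual, and follow the next arc. -/
def advance (e : (X ⊕ Y) × Fin 4) : (X ⊕ Y) × Fin 4 := D.arc (through e)

lemma through_through (e : (X ⊕ Y) × Fin 4) : through (through e) = e := by
  obtain ⟨z | z, p⟩ := e
  · simp [through]
  · have : p + 2 + 2 = p := by revert p; decide
    simp [through, this]

lemma through_isLeft (e : (X ⊕ Y) × Fin 4) : (through e).1 = e.1 := by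
  unfold through; split_ifs <;> rfl

lemma advance_injective : Function.Injective D.advance :=
  (Function.Involutive.injective D.arc_arc).comp
    (Function.Involutive.injective through_through)

lemma exists_classical [Finite X] [Finite Y] (h : X × Fin 4) :
    ∃ n, (D.advance^[n] (D.arc (Sum.inl h.1, h.2))).1.isLeft = true := by
  have hp : (Sum.inl h.1, h.2) ∈ Function.periodicPts D.advance :=
    by
    rw [Function.injective_iff_periodicPts_eq_univ.1 D.advance_injective]; trivial
  obtain ⟨n, hn, hper⟩ := hp
  obtain ⟨m, rfl⟩ := Nat.exists_eq_succ_of_ne_zero hn.ne'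
  refine ⟨m, ?_⟩
  have h1 : D.arc (Sum.inl h.1, h.2) = D.advance (Sum.inl h.1, h.2) := by
    simp [advance, through]
  rw [h1, ← Function.iterate_succ_apply, hper]
  rfl

/-- The number of virtual crossings on the way from the half-edge `h` to the next classical
crossing. -/
noncomputable def mateTime [Finite X] [Finite Y] (h : X × Fin 4) : ℕ :=
  Nat.find (D.exists_classical h)

/-- The half-edge on the other end of the edge of the universe graph that starts along the
half-edge `h`: follow the diagram, straight through virtual crossings, to the next classical
crossing. -/
noncomputable def mate [Finite X] [Finite Y] (h : X × Fin 4) : X × Fin 4 :=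
  ((D.advance^[D.mateTime h] (D.arc (Sum.inl h.1, h.2))).1.getLeft
      (Nat.find_spec (D.exists_classical h)),
    (D.advance^[D.mateTime h] (D.arc (Sum.inl h.1, h.2))).2)

lemma inl_mate [Finite X] [Finite Y] (h : X × Fin 4) :
    ((Sum.inl (D.mate h).1, (D.mate h).2) : (X ⊕ Y) × Fin 4) =
      D.advance^[D.mateTime h] (D.arc (Sum.inl h.1, h.2)) := by
  exact Prod.ext (Sum.inl_getLeft _ (Nat.find_spec (D.exists_classical h))) rfl

lemma mate_eq [Finite X] [Finite Y] {h h' : X × Fin 4} {n : ℕ}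
    (h1 : D.advance^[n] (D.arc (Sum.inl h.1, h.2)) = (Sum.inl h'.1, h'.2))
    (h2 : ∀ m < n, (D.advance^[m] (D.arc (Sum.inl h.1, h.2))).1.isLeft = false) :
    D.mate h = h' := by
  have hn : D.mateTime h = n := by
    refine (Nat.find_eq_iff _).2 ⟨by rw [h1]; rfl, fun m hm => by simp [h2 m hm]⟩
  have := D.inl_mate h
  rw [hn, h1] at this
  simp only [Prod.mk.injEq, Sum.inl.injEq] at this
  exact Prod.ext this.1 this.2

lemma isLeft_of_lt [Finite X] [Finite Y] {h : X × Fin 4} {m : ℕ} (hm : m < D.mateTime h) :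
    (D.advance^[m] (D.arc (Sum.inl h.1, h.2))).1.isLeft = false := by
  simpa using Nat.find_min (D.exists_classical h) hm

lemma advance_iterate_arc (m k : ℕ) (e : (X ⊕ Y) × Fin 4) :
    D.advance^[m] (D.arc (D.advance^[m + k] e)) = D.arc (D.advance^[k] e) := by
  induction m with
  | zero => simp
  | succ m ih =>
    rw [Function.iterate_succ_apply, Nat.add_right_comm, Function.iterate_succ_apply' _ (m + k)]
    rw [← ih]
    congr 1
    simp only [advance, D.arc_arc, through_through]

lemma mate_mate [Finite X] [Finite Y] (h : X × Fin 4) : D.mate (D.mate h) = h := by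
  apply D.mate_eq (n := D.mateTime h)
  · rw [inl_mate]
    have := D.advance_iterate_arc (D.mateTime h) 0 (D.arc (Sum.inl h.1, h.2))
    simpa [D.arc_arc] using this
  · intro m hm
    obtain ⟨k, hk⟩ := Nat.exists_eq_add_of_lt hm
    rw [inl_mate, hk, Nat.add_assoc, D.advance_iterate_arc m (k + 1),
      Function.iterate_succ_apply', advance, D.arc_arc, through_isLeft]
    exact D.isLeft_of_lt (by omega)

lemma mate_ne [Finite X] [Finite Y] (h : X × Fin 4) : D.mate h ≠ h := by
  have key : ∀ m ≤ D.mateTime h,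
      D.out (D.advance^[m] (D.arc (Sum.inl h.1, h.2))) = !D.out (Sum.inl h.1, h.2) := by
    intro m
    induction m with
    | zero => intro _; simp [D.out_arc]
    | succ m ih =>
      intro hm
      have hl := D.isLeft_of_lt (Nat.lt_of_succ_le hm)
      rw [Function.iterate_succ_apply', ← ih (by omega), advance, D.out_arc, through, hl]
      simp [D.out_opposite]
  intro heq
  have h1 := key _ le_rfl
  rw [← inl_mate, heq] at h1
  simp at h1

/-- The universe graph of `D`: its vertices are the classical crossings, its half-edges are the
ends of the classical crossings, its edges are the arcs of `D` that run from classical crossing to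
classical crossing, and there is one free loop for each link component without a classical
crossing. -/
noncomputable def universeGraph [Finite X] [Finite Y] : FourRegularGraph X (X × Fin 4) where
  vert := Prod.fst
  mate := D.mate
  mate_mate := D.mate_mate
  mate_ne := D.mate_ne
  card_vert x := by
    rw [Nat.card_congr (β := Fin 4)
      ⟨fun h => h.1.2, fun p => ⟨(x, p), rfl⟩, fun ⟨⟨_, _⟩, hx⟩ => by subst hx; rfl,
        fun _ => rfl⟩]
    simp
  freeLoops := D.freeCircles +
    Nat.card {k : D.LinkComponent // ∀ e, (Quot.mk _ e : D.LinkComponent) = k → e.1.isRight}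

/-! #### The Kauffman bracket -/

/-- The `A` smoothing of a classical crossing: it joins the two regions swept out when the
over-strand is turned counterclockwise, so the ends are paired as `{0, 1}`, `{2, 3}`. -/
def smoothingA : Fin 4 → Fin 4 := ![1, 0, 3, 2]

/-- The `B` smoothing of a classical crossing, with pairs `{0, 3}`, `{1, 2}`. -/
def smoothingB : Fin 4 → Fin 4 := ![3, 2, 1, 0]

/-- How the ends at the crossings are joined in the Kauffman state that has `B` smoothings at the
classical crossings in `T` and `A` smoothings at the others. -/
noncomputable def stateJoin (T : Finset X) : (X ⊕ Y) × Fin 4 → (X ⊕ Y) × Fin 4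
  | (Sum.inl x, p) => (Sum.inl x, if x ∈ T then smoothingB p else smoothingA p)
  | (Sum.inr y, p) => (Sum.inr y, p + 2)

/-- `c(S)`: the number of closed curves in the Kauffman state determined by `T`. -/
noncomputable def numCurves (T : Finset X) : ℕ :=
  Nat.card (Quot fun e e' : (X ⊕ Y) × Fin 4 => e' = D.arc e ∨ e' = stateJoin T e) + D.freeCircles

/-- The three-variable Kauffman bracket `∑ A ^ a(S) * B ^ b(S) * d ^ (c(S) - 1)`.
(If `D` is not empty then `c(S) ≥ 1`; the empty diagram has bracket `1`.) -/
noncomputable def kauffmanBracket [Fintype X] : Bracket.Poly :=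
  ∑ T : Finset X,
    Bracket.A ^ (Fintype.card X - T.card) * Bracket.B ^ T.card * Bracket.d ^ (D.numCurves T - 1)

/-! #### The marked interlacement graph -/

/-- The pairing of the ends at a crossing that follows the link. -/
def straight (p : Fin 4) : Fin 4 := p + 2

/-- The smoothing at a classical crossing that is consistent with the orientation of the link:
it pairs each end with the neighboring end where the orientation is opposite. -/
def orientedSmoothing (x : X) (p : Fin 4) : Fin 4 :=
  if D.out (Sum.inl x, p + 1) ≠ D.out (Sum.inl x, p) then p + 1 else p + 3

section

variable {D} [Finite X] [Finite Y] (C : D.universeGraph.EulerSystem)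

/-- `C` follows the transition `f` at the crossing `x`. -/
def Follows (x : X) (f : Fin 4 → Fin 4) : Prop := ∀ p, C.tr (x, p) = (x, f p)

/-- The transition `f` at `x` is consistent with the edge-directions obtained by orienting the
circuits of `C`: each pair contains one incoming and one outgoing half-edge. -/
def Consistent (x : X) (f : Fin 4 → Fin 4) : Prop :=
  ∀ p, ¬ C.SameDirection (x, p) (x, f p)

/-- The mark of a crossing. Three transitions are singled out at `x` by the oriented link: the one
that follows the link, the oriented smoothing, and the other (unoriented) smoothing.
* (unmarked): `C` follows the link, the oriented smoothing is consistent with `C`;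
* `r`: `C` follows the link, the unoriented smoothing is consistent with `C`;
* `c`: `C` follows the oriented smoothing, the transition of the link is consistent with `C`;
* `cr`: `C` follows the unoriented smoothing, the transition of the link is consistent with `C`;
* `u`: `C` follows the unoriented smoothing, the oriented smoothing is consistent with `C`;
* `ur`: `C` follows the oriented smoothing, the unoriented smoothing is consistent with `C`. -/
noncomputable def crossingMark (x : X) : VertexMark :=
  if Follows C x straight then
    { letter := MarkLetter.none, hasR := decide (¬ Consistent C x (D.orientedSmoothing x)) }
  else if Consistent C x straight then
    { letter := MarkLetter.c, hasR := decide (¬ Follows C x (D.orientedSmoothing x)) }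
  else
    { letter := MarkLetter.u, hasR := decide (Follows C x (D.orientedSmoothing x)) }

variable (D) in
/-- The marked interlacement graph `ℒ(D, C)`. It has `c(U) - 1` free loops. (If `D` is not empty
then `c(U) ≥ 1`; for the empty diagram this is the empty graph without free loops.) -/
noncomputable def markedInterlacementGraph : MarkedGraph X where
  graph := C.interlacement
  looped x := ¬ D.Positive x
  mark := crossingMark C
  freeLoops := D.universeGraph.numComponents - 1

end

end VirtualLinkDiagram

/-! The identity holds state by state: the curves of the state `T` number the nullity of `𝒜(G)_T`
plus `c(U)`. Let `P` be the circuit partition of the universe graph given by the state. Its circuits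
are counted by the dimension of the space of `P`-invariant `GF(2)`-valued functions on edges.

Each vertex `w` has a potential `φ w`, which changes only where `C` passes `w`. Where `P` leaves `C`
at `v`, the jump of `φ w` across `P` is the matrix entry at `v, w`: interlacement if `v ≠ w`,
inconsistency if `v = w`. A `P`-invariant `f` has the same jump `x w` across `C` at both passages of
`w`, and none where `P` follows `C`. So `f - ∑ x w * φ w` is `C`-invariant, hence constant on
components. Conversely such a sum is `P`-invariant exactly when `x` lies in the kernel of the
matrix. This gives `card_circuit_eq`.

It remains to absorb the virtual crossings into edges and free loops (`numCurves_eq`), and to check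
at a single crossing that the marks encode following and consistency (`localRemoved_spec`). -/

namespace FourRegularGraph

variable {V H : Type*} {G : FourRegularGraph V H}

/-! ### Directions along an Euler circuit -/

namespace EulerSystem

variable (C : G.EulerSystem)

lemma step_injective : Function.Injective C.step := by
  intro a b hab
  have h1 : G.mate a = G.mate b := by
    have := congrArg C.tr hab
    simpa only [step, C.tr_tr] using this
  have := congrArg G.mate h1
  simpa only [G.mate_mate] using this

lemma tr_step (h : H) : C.tr (C.step h) = G.mate h := C.tr_tr _

/-- A circuit never runs back along itself: reversal inverts `step`, so the equation can be
shortened at both ends, until `tr` or `mate` would have a fixed point. -/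
lemma iterate_step_ne_tr (k : ℕ) : ∀ h, C.step^[k] h ≠ C.tr h := by
  induction k using Nat.strong_induction_on with
  | _ k ih =>
    intro h hk
    match k, ih, hk with
    | 0, _, hk => exact C.tr_ne h hk.symm
    | 1, _, hk =>
      have := congrArg C.tr hk
      simp only [Function.iterate_one, step, C.tr_tr] at this
      exact G.mate_ne h this
    | k + 2, ih, hk =>
      apply ih k (by omega) (C.step h)
      rw [tr_step]
      apply C.step_injective
      rw [← Function.iterate_succ_apply, ← Function.iterate_succ_apply' C.step, hk]
      simp only [step, G.mate_mate]

variable {C}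

lemma SameDirection.refl (h : H) : C.SameDirection h h := ⟨0, rfl⟩

lemma SameDirection.trans {a b c : H} (hab : C.SameDirection a b) (hbc : C.SameDirection b c) :
    C.SameDirection a c := by
  obtain ⟨k, rfl⟩ := hab
  obtain ⟨l, rfl⟩ := hbc
  exact ⟨l + k, Function.iterate_add_apply _ _ _ _⟩

lemma SameDirection.exists_lt [Finite H] {a b : H} (hab : C.SameDirection a b) :
    ∃ k < Function.minimalPeriod C.step a, C.step^[k] a = b := by
  obtain ⟨k, rfl⟩ := hab
  have hp : a ∈ Function.periodicPts C.step := by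
    rw [Function.injective_iff_periodicPts_eq_univ.1 C.step_injective]; trivial
  exact ⟨k % Function.minimalPeriod C.step a,
    Nat.mod_lt _ (Function.minimalPeriod_pos_of_mem_periodicPts hp),
    Function.iterate_mod_minimalPeriod_eq⟩

lemma SameDirection.symm [Finite H] {a b : H} (hab : C.SameDirection a b) :
    C.SameDirection b a := by
  obtain ⟨k, hk, rfl⟩ := hab.exists_lt
  refine ⟨Function.minimalPeriod C.step a - k, ?_⟩
  rw [← Function.iterate_add_apply, Nat.sub_add_cancel hk.le, Function.iterate_minimalPeriod]

lemma SameDirection.not_tr {a b : H} (hab : C.SameDirection a b) [Finite H] :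
    ¬ C.SameDirection a (C.tr b) := by
  intro h
  obtain ⟨k, hk⟩ := hab.symm.trans h
  exact C.iterate_step_ne_tr k b hk

lemma sameDirection_step (h : H) : C.SameDirection h (C.step h) := ⟨1, rfl⟩

/-- `mate` and `tr` both exchange the two directions of a circuit, so the disjunction is constant on
circuits, of which each component has one. -/
lemma sameDirection_or [Finite H] {a b : H}
    (hab : (Quot.mk _ (G.vert a) : G.Component) = Quot.mk _ (G.vert b)) :
    C.SameDirection a b ∨ C.SameDirection a (C.tr b) := by
  have key : ∀ x y : H, (y = G.mate x ∨ y = C.tr x) →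
      (C.SameDirection a x ∨ C.SameDirection a (C.tr x)) →
      (C.SameDirection a y ∨ C.SameDirection a (C.tr y)) := by
    rintro x y (rfl | rfl) h
    · rcases h with h | h
      · exact Or.inr (h.trans (sameDirection_step x))
      · left
        have h2 := sameDirection_step (C := C) (G.mate x)
        rw [step, G.mate_mate] at h2
        exact h.trans h2.symm
    · rw [C.tr_tr]
      exact h.symm
  have key' : ∀ x y : H, (y = G.mate x ∨ y = C.tr x) →
      ((C.SameDirection a x ∨ C.SameDirection a (C.tr x)) =
      (C.SameDirection a y ∨ C.SameDirection a (C.tr y))) := by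
    intro x y h
    refine propext ⟨key x y h, key y x ?_⟩
    rcases h with rfl | rfl
    · exact Or.inl (G.mate_mate x).symm
    · exact Or.inr (C.tr_tr x).symm
  have := congrArg (Quot.lift _ key') (C.euler a b hab)
  exact this.mp (Or.inl (SameDirection.refl a))

lemma not_sameDirection_iff [Finite H] {a b : H}
    (hab : (Quot.mk _ (G.vert a) : G.Component) = Quot.mk _ (G.vert b)) :
    ¬ C.SameDirection a b ↔ C.SameDirection a (C.tr b) :=
  ⟨fun h => (sameDirection_or hab).resolve_left h, fun h h' => h'.not_tr h⟩

variable (C) in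
lemma eq_of_vert_eq [Finite H] {a b k : H} (hb : G.vert b = G.vert a) (hk : G.vert k = G.vert a)
    (h1 : b ≠ a) (h2 : b ≠ C.tr a) : k = a ∨ k = b ∨ k = C.tr a ∨ k = C.tr b := by
  by_contra hne
  push Not at hne
  obtain ⟨n1, n2, n3, n4⟩ := hne
  have hcard := G.card_vert (G.vert a)
  have := Fintype.ofFinite H
  rw [Nat.card_eq_fintype_card, Fintype.card_subtype] at hcard
  have hsub : ({k, a, b, C.tr a, C.tr b} : Finset H) ⊆
      Finset.univ.filter fun h => G.vert h = G.vert a := by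
    intro z hz
    simp only [Finset.mem_insert, Finset.mem_singleton] at hz
    rcases hz with rfl | rfl | rfl | rfl | rfl <;> simp [C.vert_tr, hb, hk]
  have h3 : a ≠ C.tr b := fun h => h2 (by rw [h, C.tr_tr])
  have h4 : C.tr a ≠ C.tr b := fun h => h1 (by rw [← C.tr_tr b, ← h, C.tr_tr])
  have h5 : ({k, a, b, C.tr a, C.tr b} : Finset H).card = 5 := by
    rw [Finset.card_insert_of_notMem, Finset.card_insert_of_notMem, Finset.card_insert_of_notMem,
      Finset.card_insert_of_notMem, Finset.card_singleton]
    · simpa using h4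
    · simpa using ⟨h2, (C.tr_ne b).symm⟩
    · simpa using ⟨h1.symm, (C.tr_ne a).symm, h3⟩
    · simpa using ⟨n1, n2, n3, n4⟩
  have := Finset.card_le_card hsub
  omega

lemma exists_vert_eq (v : V) : ∃ h, G.vert h = v := by
  have := G.card_vert v
  by_contra hne
  push Not at hne
  have : IsEmpty {h : H // G.vert h = v} := ⟨fun h => hne h.1 h.2⟩
  simp_all

variable (C) in
-- The circuit leaves every vertex twice; `b` is the other departure.
lemma exists_sameDirection [Finite H] (a : H) :
    ∃ b, G.vert b = G.vert a ∧ b ≠ a ∧ C.SameDirection a b := by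
  have : ∃ b, G.vert b = G.vert a ∧ b ≠ a ∧ b ≠ C.tr a := by
    by_contra hne
    push Not at hne
    have hcard := G.card_vert (G.vert a)
    have := Fintype.ofFinite H
    rw [Nat.card_eq_fintype_card, Fintype.card_subtype] at hcard
    have hsub : (Finset.univ.filter fun h => G.vert h = G.vert a) ⊆ {a, C.tr a} := by
      intro z hz
      simp only [Finset.mem_filter, Finset.mem_univ, true_and] at hz
      simp only [Finset.mem_insert, Finset.mem_singleton]
      by_cases h : z = a
      · exact Or.inl h
      · exact Or.inr (hne z hz h)
    have := (Finset.card_le_card hsub).trans Finset.card_le_two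
    omega
  obtain ⟨b, hb, h1, h2⟩ := this
  rcases sameDirection_or (C := C) (a := a) (b := b) (by rw [hb]) with h | h
  · exact ⟨b, hb, h1, h⟩
  · refine ⟨C.tr b, by rw [C.vert_tr, hb], fun h => h2 (by rw [← h, C.tr_tr]), h⟩

/-! ### Potentials -/

variable (C) in
/-- A `GF(2)`-valued function on the edges that changes precisely at the two passages of the
Euler system through the vertex `w`. -/
structure IsPotential (w : V) (f : H → ZMod 2) : Prop where
  mate : ∀ h, f (G.mate h) = f h
  tr : ∀ h, f (C.tr h) = f h + if G.vert h = w then 1 else 0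

variable (C) in
/-- The sum of the indicators of the first `j` edges that the circuit of `C` traverses when it
leaves along `h`. -/
noncomputable def arcIndicator (h : H) (j : ℕ) (g : H) : ZMod 2 :=
  ∑ i ∈ Finset.range j,
    ((if g = C.step^[i] h then 1 else 0) + if g = G.mate (C.step^[i] h) then 1 else 0)

/-- The two passages through a vertex cut its circuit into two arcs, and the indicator of one arc
changes just at these passages. -/
lemma isPotential_arcIndicator [Finite H] {h : H} {j : ℕ}
    (hv : G.vert (C.step^[j] h) = G.vert h) (hne : C.step^[j] h ≠ h) :
    C.IsPotential (G.vert h) (C.arcIndicator h j) := by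
  have mm : ∀ a b : H, (G.mate a = b) = (a = G.mate b) := fun a b =>
    propext ⟨fun h => by rw [← h, G.mate_mate], fun h => by rw [h, G.mate_mate]⟩
  have tt : ∀ a b : H, (C.tr a = b) = (a = C.tr b) := fun a b =>
    propext ⟨fun h => by rw [← h, C.tr_tr], fun h => by rw [h, C.tr_tr]⟩
  refine ⟨fun g => ?_, fun g => ?_⟩
  · refine Finset.sum_congr rfl fun i _ => ?_
    rw [mm, mm, G.mate_mate, add_comm]
  -- `u i` tests whether `g` belongs to the passage that departs along `step^[i] h`. The change
  -- across `C` telescopes to the passages `0` and `j`, which together use all four half-edges of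
  -- the vertex.
  · let u : ℕ → ZMod 2 := fun i => (if g = C.step^[i] h then 1 else 0) +
      if g = C.tr (C.step^[i] h) then 1 else 0
    have h2 : ∀ a : ZMod 2, a + a = 0 := CharTwo.add_self_eq_zero
    have h1 : C.arcIndicator h j (C.tr g) + C.arcIndicator h j g = u 0 + u j := by
      have hs : C.arcIndicator h j (C.tr g) + C.arcIndicator h j g =
          ∑ i ∈ Finset.range j, (u (i + 1) - u i) := by
        rw [arcIndicator, arcIndicator, ← Finset.sum_add_distrib]
        refine Finset.sum_congr rfl fun i _ => ?_
        simp only [u]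
        rw [tt, tt, Function.iterate_succ_apply', tr_step, CharTwo.sub_eq_add,
          show C.step (C.step^[i] h) = C.tr (G.mate (C.step^[i] h)) from rfl]
        ring
      rw [hs, Finset.sum_range_sub, CharTwo.sub_eq_add, add_comm]
    have h3 : u 0 + u j = if G.vert g = G.vert h then 1 else 0 := by
      simp only [u, Function.iterate_zero, id]
      have htr : C.step^[j] h ≠ C.tr h := C.iterate_step_ne_tr j h
      have e1 : h ≠ C.tr h := (C.tr_ne h).symm
      have e2 : C.step^[j] h ≠ C.tr (C.step^[j] h) := (C.tr_ne _).symm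
      have e3 : h ≠ C.tr (C.step^[j] h) := fun e => htr (by rw [← tt, ← e])
      have e4 : C.tr (C.step^[j] h) ≠ C.tr h := by rw [Ne, tt, C.tr_tr]; exact hne
      by_cases hg : G.vert g = G.vert h
      · rw [if_pos hg]
        rcases C.eq_of_vert_eq hv hg hne htr with rfl | rfl | rfl | rfl
        · simp [e1, hne.symm, e3]
        · simp [hne, htr, e2]
        · simp [e1.symm, htr.symm, e4.symm]
        · simp [e3.symm, e2.symm, e4]
      · rw [if_neg hg]
        have f1 : g ≠ h := by rintro rfl; exact hg rfl
        have f2 : g ≠ C.tr h := by rintro rfl; exact hg (C.vert_tr _)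
        have f3 : g ≠ C.step^[j] h := by rintro rfl; exact hg hv
        have f4 : g ≠ C.tr (C.step^[j] h) := by
          rintro rfl; exact hg ((C.vert_tr _).trans hv)
        simp [f1, f2, f3, f4]
    rw [← h3, ← h1, add_left_comm, h2, add_zero]

/-- The `mate` terms vanish because those half-edges point against the circuit, and departures
within one period are distinct. -/
lemma arcIndicator_iterate [Finite H] (h : H) {i j : ℕ} (hi : i < Function.minimalPeriod C.step h)
    (hj : j < Function.minimalPeriod C.step h) :
    C.arcIndicator h j (C.step^[i] h) = if i < j then 1 else 0 := by
  have h1 : ∀ k ∈ Finset.range j, ((if C.step^[i] h = C.step^[k] h then (1 : ZMod 2) else 0) +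
      if C.step^[i] h = G.mate (C.step^[k] h) then 1 else 0) = if i = k then 1 else 0 := by
    intro k hk
    have hk' := (Finset.mem_range.1 hk).trans hj
    have e1 : C.step^[i] h ≠ G.mate (C.step^[k] h) := by
      rw [← tr_step, ← Function.iterate_succ_apply' C.step]
      intro e
      have s1 : C.SameDirection h (C.step^[i] h) := ⟨i, rfl⟩
      have s2 : C.SameDirection h (C.step^[k + 1] h) := ⟨k + 1, rfl⟩
      exact s2.not_tr (e ▸ s1)
    have e2 : C.step^[i] h = C.step^[k] h ↔ i = k :=
      ⟨fun e => Function.iterate_injOn_Iio_minimalPeriod hi hk' e, fun e => by rw [e]⟩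
    simp [e1, e2]
  rw [arcIndicator, Finset.sum_congr rfl h1]
  simp

lemma component_mate (h : H) :
    (Quot.mk _ (G.vert (G.mate h)) : G.Component) = Quot.mk _ (G.vert h) :=
  (Quot.sound ⟨h, rfl, rfl⟩).symm

lemma component_iterate_step (h : H) (i : ℕ) :
    (Quot.mk _ (G.vert (C.step^[i] h)) : G.Component) = Quot.mk _ (G.vert h) := by
  induction i with
  | zero => rfl
  | succ i ih => rw [Function.iterate_succ_apply', step, C.vert_tr, component_mate, ih]

lemma component_eq_of_arcIndicator_ne_zero {h : H} {j : ℕ} {g : H}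
    (hg : C.arcIndicator h j g ≠ 0) :
    (Quot.mk _ (G.vert h) : G.Component) = Quot.mk _ (G.vert g) := by
  obtain ⟨i, -, hi⟩ := Finset.exists_ne_zero_of_sum_ne_zero hg
  by_cases h1 : g = C.step^[i] h
  · rw [h1, component_iterate_step]
  · by_cases h2 : g = G.mate (C.step^[i] h)
    · rw [h2, component_mate, component_iterate_step]
    · simp [h1, h2] at hi

variable (C) in
lemma exists_isPotential [Finite H] (w : V) : ∃ f, C.IsPotential w f := by
  obtain ⟨h, rfl⟩ := exists_vert_eq (G := G) w
  obtain ⟨b, hb, hne, k, rfl⟩ := C.exists_sameDirection h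
  exact ⟨_, isPotential_arcIndicator hb hne⟩

lemma eq_of_invariant {f : H → ZMod 2} (h1 : ∀ h, f (G.mate h) = f h)
    (h2 : ∀ h, f (C.tr h) = f h) {a b : H}
    (hab : (Quot.mk _ (G.vert a) : G.Component) = Quot.mk _ (G.vert b)) : f a = f b := by
  have key : ∀ x y : H, (y = G.mate x ∨ y = C.tr x) → f x = f y := by
    rintro x y (rfl | rfl)
    · exact (h1 x).symm
    · exact (h2 x).symm
  exact congrArg (Quot.lift f key) (C.euler a b hab)

/-- The difference of two potentials of `w` jumps nowhere, so it is constant on components. Any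
potential may thus be replaced by an arc indicator. -/
lemma IsPotential.add_eq_add {w : V} {f f' : H → ZMod 2} (hf : C.IsPotential w f)
    (hf' : C.IsPotential w f') {a b : H}
    (hab : (Quot.mk _ (G.vert a) : G.Component) = Quot.mk _ (G.vert b)) :
    f a + f b = f' a + f' b := by
  have h := eq_of_invariant (C := C) (f := fun h => f h - f' h)
    (fun h => by simp only [hf.mate, hf'.mate])
    (fun h => by simp only [hf.tr, hf'.tr]; ring) hab
  have h2 : ∀ a b a' b' : ZMod 2, a - a' = b - b' → a + b = a' + b' := by decide
  exact h2 _ _ _ _ h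

/-! ### Interlacement read off from potentials -/

lemma Interlaced.symm {v w : V} (h : C.Interlaced v w) : C.Interlaced w v := by
  obtain ⟨h, i, j, k, hij, hjk, hk, h0, hi, hj, hk'⟩ := h
  -- Starting the circuit at index `i` moves the first passage to index `period - i`, which is below
  -- the period only if `i > 0`.
  rcases Nat.eq_zero_or_pos i with rfl | hi0
  · obtain rfl : v = w := h0.symm.trans hi
    exact ⟨h, 0, j, k, hij, hjk, hk, h0, hi, hj, hk'⟩
  have hp : h ∈ Function.periodicPts C.step :=
    Function.minimalPeriod_pos_iff_mem_periodicPts.1 (by omega)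
  refine ⟨C.step^[i] h, j - i, k - i, Function.minimalPeriod C.step h - i, by omega, by omega,
    ?_, hi, ?_, ?_, ?_⟩
  · rw [Function.minimalPeriod_apply_iterate hp]
    omega
  · rw [← Function.iterate_add_apply, Nat.sub_add_cancel (by omega), hj]
  · rw [← Function.iterate_add_apply, Nat.sub_add_cancel (by omega), hk']
  · rw [← Function.iterate_add_apply, Nat.sub_add_cancel (by omega),
      Function.iterate_minimalPeriod, h0]

lemma interlacement_adj {v w : V} : C.interlacement.Adj v w ↔ v ≠ w ∧ C.Interlaced v w := by
  rw [interlacement, SimpleGraph.fromRel_adj]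
  exact and_congr_right fun _ => ⟨fun h => h.elim id Interlaced.symm, Or.inl⟩

lemma IsPotential.add_eq_one_of_sameDirection [Finite H] {f : H → ZMod 2} {a b : H}
    (hf : C.IsPotential (G.vert a) f) (hb : G.vert b = G.vert a) (hne : b ≠ a)
    (hab : C.SameDirection a b) : f a + f b = 1 := by
  obtain ⟨j, hj, rfl⟩ := hab.exists_lt
  have h0 : 0 < j := Nat.pos_of_ne_zero fun h => hne (by rw [h]; rfl)
  rw [hf.add_eq_add (isPotential_arcIndicator hb hne) (by rw [hb]),
    arcIndicator_iterate a hj hj]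
  have := arcIndicator_iterate (C := C) a (i := 0) (h0.trans hj) hj
  rw [Function.iterate_zero, id] at this
  simp [this, h0]

/-- `a` and `b` belong to different passages of their vertex; their values differ iff `w` separates
these passages, one on each arc. -/
lemma IsPotential.add_eq_iff_interlaced [Finite H] {w : V} {f : H → ZMod 2} {a b : H}
    (hf : C.IsPotential w f) (hw : G.vert a ≠ w) (hb : G.vert b = G.vert a) (h1 : b ≠ a)
    (h2 : b ≠ C.tr a) : f a + f b = 1 ↔ C.Interlaced (G.vert a) w := by
  have ftr : ∀ g, G.vert g = G.vert a → f (C.tr g) = f g := fun g hg => by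
    rw [hf.tr, if_neg (by rwa [hg]), add_zero]
  constructor
  · intro hab
    obtain ⟨h, rfl⟩ := exists_vert_eq (G := G) w
    obtain ⟨h', hv, hne, hs⟩ := C.exists_sameDirection h
    obtain ⟨j, hj, rfl⟩ := hs.exists_lt
    have hcomp : (Quot.mk _ (G.vert h) : G.Component) = Quot.mk _ (G.vert a) := by
      -- On another component the arc indicator is zero, so the sum could not be `1`.
      by_contra hc
      have hp := isPotential_arcIndicator hv hne
      have hb' := component_eq_of_arcIndicator_ne_zero (C := C) (h := h) (j := j) (g := b)
      have ha' := component_eq_of_arcIndicator_ne_zero (C := C) (h := h) (j := j) (g := a)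
      rw [hb] at hb'
      rw [hf.add_eq_add hp (by rw [hb]), not_not.1 (mt ha' hc), not_not.1 (mt hb' hc)] at hab
      simp at hab
    have hc' : (Quot.mk _ (G.vert h) : G.Component) = Quot.mk _ (G.vert b) := by rw [hb, hcomp]
    have key : ∀ a b : H, G.vert a ≠ G.vert h → G.vert b = G.vert a → C.SameDirection h a →
        C.SameDirection h b → C.arcIndicator h j a = 1 → C.arcIndicator h j b = 0 →
        C.Interlaced (G.vert a) (G.vert h) := by
      intro a b hah hba ha hb fa fb
      obtain ⟨i, hi, rfl⟩ := ha.exists_lt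
      obtain ⟨k, hk, rfl⟩ := hb.exists_lt
      rw [arcIndicator_iterate h hi hj] at fa
      rw [arcIndicator_iterate h hk hj] at fb
      have hij : i < j := by by_contra h; simp [h] at fa
      have hjk : ¬ k < j := by intro h; simp [h] at fb
      have h0 : 0 < i := Nat.pos_of_ne_zero fun h => hah (by rw [h]; rfl)
      have hjk' : j ≠ k := by rintro rfl; exact hah (hba.symm.trans hv)
      have : C.Interlaced (G.vert h) (G.vert (C.step^[i] h)) :=
        ⟨h, i, j, k, hij, by omega, hk, rfl, rfl, hv, hba⟩
      exact this.symm
    have hp := isPotential_arcIndicator hv hne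
    have gtr : ∀ g, G.vert g = G.vert a → C.arcIndicator h j (C.tr g) = C.arcIndicator h j g :=
      fun g hg => by rw [hp.tr, if_neg (by rwa [hg]), add_zero]
    rw [hf.add_eq_add hp (by rw [hb])] at hab
    -- Away from `w` both half-edges of a passage have the same value, so the departing one may be
    -- taken.
    obtain ⟨a', ha', sa, ea⟩ : ∃ a', G.vert a' = G.vert a ∧ C.SameDirection h a' ∧
        C.arcIndicator h j a' = C.arcIndicator h j a := by
      rcases sameDirection_or (C := C) hcomp with hs | hs
      · exact ⟨a, rfl, hs, rfl⟩
      · exact ⟨C.tr a, C.vert_tr a, hs, gtr a rfl⟩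
    obtain ⟨b', hb', sb, eb⟩ : ∃ b', G.vert b' = G.vert a ∧ C.SameDirection h b' ∧
        C.arcIndicator h j b' = C.arcIndicator h j b := by
      rcases sameDirection_or (C := C) hc' with hs | hs
      · exact ⟨b, hb, hs, rfl⟩
      · exact ⟨C.tr b, (C.vert_tr b).trans hb, hs, gtr b hb⟩
    rw [← ea, ← eb] at hab
    have hz : ∀ x y : ZMod 2, x + y = 1 → (x = 1 ∧ y = 0) ∨ (y = 1 ∧ x = 0) := by decide
    rcases hz _ _ hab with ⟨hx, hy⟩ | ⟨hx, hy⟩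
    · rw [← ha']
      exact key a' b' (by rwa [ha']) (hb'.trans ha'.symm) sa sb hx hy
    · rw [← hb']
      exact key b' a' (by rwa [hb']) (ha'.trans hb'.symm) sb sa hx hy
  · intro hi
    obtain ⟨h, i, j, k, hij, hjk, hk, rfl, hi, hj, hk'⟩ := hi.symm
    have hj' := hjk.trans hk
    have hne : C.step^[j] h ≠ h := fun e => by
      have := Function.IsPeriodicPt.minimalPeriod_le (f := C.step) (x := h) (n := j) (by omega) e
      omega
    have hp := isPotential_arcIndicator hj hne
    have hik : f (C.step^[i] h) + f (C.step^[k] h) = 1 := by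
      rw [hf.add_eq_add hp (by rw [hi, hk']), arcIndicator_iterate h (hij.trans hj') hj',
        arcIndicator_iterate h hk hj', if_pos hij, if_neg (by omega), add_zero]
    have hfk : ∀ c, G.vert c = G.vert a → f c = f a ∨ f c = f b := by
      intro c hc
      rcases C.eq_of_vert_eq hb hc h1 h2 with rfl | rfl | rfl | rfl
      · exact Or.inl rfl
      · exact Or.inr rfl
      · exact Or.inl (ftr _ rfl)
      · exact Or.inr (ftr _ hb)
    have hz : ∀ x y z w : ZMod 2, (x = z ∨ x = w) → (y = z ∨ y = w) → x + y = 1 → z + w = 1 := by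
      decide
    exact hz _ _ _ _ (hfk _ hi) (hfk _ hk') hik

end EulerSystem

/-! ### The circuit-nullity formula -/

instance [Finite V] : Finite G.Component := inferInstanceAs (Finite (Quot _))

instance [Finite H] (P : G.CircuitPartition) : Finite P.Circuit :=
  inferInstanceAs (Finite (Quot _))

/-- The circuit-nullity formula: the rows and columns of the vertices where `P` follows `C` are
removed from the interlacement matrix, and the diagonal entry `1` marks the vertices where the
transition of `P` is not consistent with `C`. -/
theorem card_circuit_eq [Fintype V] [Finite H] (C : G.EulerSystem) (P : G.CircuitPartition)
    (R : V → Prop) (N : Matrix V V (ZMod 2))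
    (hN : ∀ v w, v ≠ w → N v w = if C.interlacement.Adj v w then 1 else 0)
    (hR : ∀ h, R (G.vert h) ↔ P.tr h = C.tr h)
    (hd : ∀ h, ¬ R (G.vert h) → (N (G.vert h) (G.vert h) = 1 ↔ C.SameDirection h (P.tr h))) :
    Nat.card P.Circuit = Module.finrank (ZMod 2) (LinearMap.ker
      (N.submatrix (Subtype.val : {v // ¬ R v} → V) (Subtype.val : {v // ¬ R v} → V)).mulVecLin) +
        Nat.card G.Component := by
  have hz : ∀ x y : ZMod 2, (x = 1 ↔ y = 1) → x = y := by decide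
  have h2 : ∀ a : ZMod 2, a + a = 0 := CharTwo.add_self_eq_zero
  choose φ hφ using C.exists_isPotential
  -- The matrix entries are the jumps of the potentials across `P`.
  have hφN : ∀ h, ¬ R (G.vert h) → ∀ w, φ w (P.tr h) = φ w h + N (G.vert h) w := by
    intro h hh w
    have hP := mt (hR h).2 hh
    have : φ w h + φ w (P.tr h) = N (G.vert h) w := by
      apply hz
      by_cases hw : G.vert h = w
      · subst hw
        rw [hd h hh]
        constructor
        -- If `P` were consistent here, `C.tr (P.tr h)` would be the second departure. The jumps
        -- across `P` and then `C` would add up to `1`, and the one across `C` is already `1`.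
        · intro h1
          by_contra hs
          rw [EulerSystem.not_sameDirection_iff (by rw [P.vert_tr])] at hs
          have := (hφ _).add_eq_one_of_sameDirection (by rw [C.vert_tr, P.vert_tr])
            (fun e => hP (by rw [← C.tr_tr (P.tr h), e])) hs
          rw [(hφ _).tr, P.vert_tr, if_pos rfl, ← add_assoc, h1] at this
          exact absurd this (by decide)
        · exact (hφ _).add_eq_one_of_sameDirection (P.vert_tr h) (P.tr_ne h)
      · rw [(hφ w).add_eq_iff_interlaced hw (P.vert_tr h) (P.tr_ne h) hP, hN _ _ hw,
          EulerSystem.interlacement_adj]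
        simp [hw]
    rw [← this, ← add_assoc, h2, zero_add]
  let K := LinearMap.ker
      (N.submatrix (Subtype.val : {v // ¬ R v} → V) (Subtype.val : {v // ¬ R v} → V)).mulVecLin
  -- `M` and `L` are injective with the same image, the functions invariant under `mate` and `P.tr`;
  -- comparing dimensions gives the formula.
  let M : (P.Circuit → ZMod 2) →ₗ[ZMod 2] (H → ZMod 2) :=
    LinearMap.funLeft (ZMod 2) (ZMod 2) (Quot.mk _)
  let L : (K × (G.Component → ZMod 2)) →ₗ[ZMod 2] (H → ZMod 2) :=
    LinearMap.coprod
      ((Fintype.linearCombination (ZMod 2) fun v : {v // ¬ R v} => φ v).comp K.subtype)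
      (LinearMap.funLeft (ZMod 2) (ZMod 2) fun h => Quot.mk _ (G.vert h))
  have hL : ∀ (x : K) a h, L (x, a) h =
      ∑ w : {v // ¬ R v}, x.1 w * φ w h + a (Quot.mk _ (G.vert h)) := by
    intro x a h
    simp only [L, LinearMap.coprod_apply, LinearMap.comp_apply, Submodule.subtype_apply,
      Fintype.linearCombination_apply, Pi.add_apply, Finset.sum_apply, Pi.smul_apply, smul_eq_mul]
    rfl
  have hLtr : ∀ (x : {v // ¬ R v} → ZMod 2) h, ∑ w : {v // ¬ R v}, x w * φ w (C.tr h) =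
      ∑ w : {v // ¬ R v}, x w * φ w h +
        if hh : ¬ R (G.vert h) then x ⟨G.vert h, hh⟩ else 0 := by
    intro x h
    simp only [(hφ _).tr, mul_add, Finset.sum_add_distrib]
    congr 1
    by_cases hh : R (G.vert h)
    · rw [dif_neg (not_not.2 hh)]
      refine Finset.sum_eq_zero fun w _ => ?_
      rw [if_neg (fun e : G.vert h = w => w.2 (e ▸ hh)), mul_zero]
    · rw [dif_pos hh, Finset.sum_eq_single ⟨G.vert h, hh⟩]
      · simp
      · intro b _ hb
        rw [if_neg (fun e => hb (Subtype.ext e.symm)), mul_zero]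
      · simp
  have hMinj : Function.Injective M :=
    LinearMap.funLeft_injective_of_surjective _ _ _ Quot.mk_surjective
  have hLinj : Function.Injective L := by
    rw [injective_iff_map_eq_zero]
    rintro ⟨x, a⟩ h0
    -- The coefficient at `v` is recovered as the jump across `C` at `v`.
    have hx : x = 0 := by
      apply Subtype.ext
      funext v
      obtain ⟨h, hv⟩ := EulerSystem.exists_vert_eq (G := G) v.1
      have e1 := congrFun h0 h
      have e2 := congrFun h0 (C.tr h)
      rw [hL] at e1 e2
      rw [hLtr, C.vert_tr, dif_pos (by rw [hv]; exact v.2), add_right_comm, e1] at e2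
      simpa [hv] using e2
    subst hx
    have ha : a = 0 := by
      funext k
      induction k using Quot.ind with
      | _ v =>
        obtain ⟨h, rfl⟩ := EulerSystem.exists_vert_eq (G := G) v
        have e1 := congrFun h0 h
        rw [hL] at e1
        simp only [Submodule.coe_zero, Pi.zero_apply, zero_mul, Finset.sum_const_zero,
          zero_add] at e1
        exact e1
    rw [ha]
    rfl
  have hrange : LinearMap.range M = LinearMap.range L := by
    apply le_antisymm
    · rintro _ ⟨q, rfl⟩
      set f : H → ZMod 2 := M q
      have fm : ∀ h, f (G.mate h) = f h := fun h =>
        congrArg q (Quot.sound (r := fun h h' => h' = G.mate h ∨ h' = P.tr h) (Or.inl rfl)).symm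
      have fP : ∀ h, f (P.tr h) = f h := fun h =>
        congrArg q (Quot.sound (r := fun h h' => h' = G.mate h ∨ h' = P.tr h) (Or.inr rfl)).symm
      choose s hs using EulerSystem.exists_vert_eq (G := G)
      let x : {v // ¬ R v} → ZMod 2 := fun v => f (s v) + f (C.tr (s v))
      have hfC : ∀ h, f (C.tr h) =
          f h + if hh : ¬ R (G.vert h) then x ⟨G.vert h, hh⟩ else 0 := by
        intro h
        by_cases hh : R (G.vert h)
        · rw [dif_neg (not_not.2 hh), add_zero, ← (hR h).1 hh, fP]
        · rw [dif_pos hh]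
          have hne : P.tr h ≠ C.tr h := mt (hR h).2 hh
          -- Distinct pairings of four half-edges commute, so the jump of `f` across `C` does not
          -- depend on the half-edge chosen at the vertex.
          have hcomm : C.tr (P.tr h) = P.tr (C.tr h) := by
            have hv : G.vert (P.tr (C.tr h)) = G.vert h := (P.vert_tr _).trans (C.vert_tr h)
            rcases C.eq_of_vert_eq (P.vert_tr h) hv (P.tr_ne h) hne with e | e | e | e
            · exact absurd (by simpa only [P.tr_tr] using (congrArg P.tr e).symm) hne
            · exact absurd (by simpa only [P.tr_tr] using congrArg P.tr e) (C.tr_ne h)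
            · exact absurd e (P.tr_ne _)
            · exact e.symm
          have hfc : f (C.tr (P.tr h)) = f (C.tr h) := by rw [hcomm, fP]
          have ht : f (C.tr h) + f h =
              f (s (G.vert h)) + f (C.tr (s (G.vert h))) := by
            rcases C.eq_of_vert_eq (P.vert_tr h) (hs (G.vert h)) (P.tr_ne h) hne
              with e | e | e | e <;> rw [e] <;> simp only [C.tr_tr, hfc, fP, add_comm]
          change f (C.tr h) = f h + (f (s (G.vert h)) + f (C.tr (s (G.vert h))))
          rw [← ht, add_left_comm, h2, add_zero]
      -- The jumps across `C` have been removed, so `g` is constant on components.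
      let g : H → ZMod 2 := fun h => f h - ∑ w : {v // ¬ R v}, x w * φ w h
      have hg : ∀ a b, (Quot.mk _ (G.vert a) : G.Component) = Quot.mk _ (G.vert b) →
          g a = g b := by
        intro a b hab
        refine EulerSystem.eq_of_invariant (C := C) (fun h => ?_) (fun h => ?_) hab
        · simp only [g, fm, (hφ _).mate]
        · simp only [g]
          rw [hfC, hLtr]
          ring
      have hx : x ∈ K := by
        rw [LinearMap.mem_ker]
        funext v
        obtain ⟨h, hv⟩ := EulerSystem.exists_vert_eq (G := G) v.1
        have hh : ¬ R (G.vert h) := by rw [hv]; exact v.2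
        -- Since `f` and `g` both agree at `h` and `P.tr h`, so does the sum of potentials; its jump
        -- across `P` is this row of the matrix applied to `x`.
        have e := hg h (P.tr h) (by rw [P.vert_tr])
        simp only [g, fP, hφN h hh, mul_add, Finset.sum_add_distrib] at e
        simp only [Matrix.mulVecLin_apply, Matrix.mulVec, dotProduct, Matrix.submatrix_apply,
          Pi.zero_apply]
        rw [← hv]
        simp only [mul_comm (N _ _)]
        linear_combination e
      refine ⟨(⟨x, hx⟩, fun k => g (s k.out)), ?_⟩
      funext h
      rw [hL, hg (s (Quot.out _)) h (by rw [hs, Quot.out_eq])]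
      simp only [g]
      ring
    · rintro _ ⟨⟨x, a⟩, rfl⟩
      have key : ∀ h h' : H, (h' = G.mate h ∨ h' = P.tr h) → L (x, a) h = L (x, a) h' := by
        rintro h h' (rfl | rfl)
        · rw [hL, hL, EulerSystem.component_mate]
          simp only [(hφ _).mate]
        · rw [hL, hL, P.vert_tr]
          congr 1
          by_cases hh : R (G.vert h)
          · rw [(hR h).1 hh, hLtr, dif_neg (not_not.2 hh), add_zero]
          · have hx := congrFun (LinearMap.mem_ker.1 x.2) ⟨G.vert h, hh⟩
            simp only [Matrix.mulVecLin_apply, Matrix.mulVec, dotProduct, Matrix.submatrix_apply,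
              Pi.zero_apply] at hx
            simp only [hφN h hh, mul_add, Finset.sum_add_distrib]
            simp only [mul_comm (N _ _)] at hx
            rw [hx, add_zero]
      exact ⟨Quot.lift (L (x, a)) key, rfl⟩
  have e1 := LinearMap.finrank_range_of_inj hMinj
  have e2 := LinearMap.finrank_range_of_inj hLinj
  have := Fintype.ofFinite P.Circuit
  have := Fintype.ofFinite G.Component
  rw [hrange, e2, Module.finrank_prod, Module.finrank_fintype_fun_eq_card,
    Module.finrank_fintype_fun_eq_card] at e1
  rw [Nat.card_eq_fintype_card, Nat.card_eq_fintype_card, ← e1]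

end FourRegularGraph

namespace VirtualLinkDiagram

variable {X Y : Type*} (D : VirtualLinkDiagram X Y)

/-! ### Elimination of the virtual crossings -/

/-- Starting at the end `e`, and going straight through virtual crossings, the first end at a
classical crossing is `h`. -/
def Reaches (e : (X ⊕ Y) × Fin 4) (h : X × Fin 4) : Prop :=
  ∃ n, D.advance^[n] e = (Sum.inl h.1, h.2) ∧ ∀ m < n, (D.advance^[m] e).1.isLeft = false

variable {D}

lemma reaches_inl (h : X × Fin 4) : D.Reaches (Sum.inl h.1, h.2) h :=
  ⟨0, rfl, fun _ hm => absurd hm (Nat.not_lt_zero _)⟩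

lemma Reaches.unique {e : (X ⊕ Y) × Fin 4} {h h' : X × Fin 4} (h1 : D.Reaches e h)
    (h2 : D.Reaches e h') : h = h' := by
  obtain ⟨n, hn, hn'⟩ := h1
  obtain ⟨m, hm, hm'⟩ := h2
  obtain hlt | rfl | hlt := lt_trichotomy n m
  · simpa [hn] using hm' n hlt
  · rw [hn] at hm
    simp only [Prod.mk.injEq, Sum.inl.injEq] at hm
    exact Prod.ext hm.1 hm.2
  · simpa [hm] using hn' m hlt

/-- Read backwards, the path from `e` to `h` is an initial part of the edge that starts along `h`;
the rest of that edge leads from `arc e` to `mate h`. -/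
lemma Reaches.arc [Finite X] [Finite Y] {e : (X ⊕ Y) × Fin 4} {h : X × Fin 4}
    (hr : D.Reaches e h) : D.Reaches (D.arc e) (D.mate h) := by
  obtain ⟨n, hn, hn'⟩ := hr
  have h1 : D.advance^[n] (D.arc (Sum.inl h.1, h.2)) = D.arc e := by
    rw [← hn]
    exact D.advance_iterate_arc n 0 e
  have h2 : ∀ m < n, (D.advance^[m] (D.arc (Sum.inl h.1, h.2))).1.isLeft = false := by
    intro m hm
    obtain ⟨k, hk⟩ := Nat.exists_eq_add_of_lt hm
    rw [← hn, hk, Nat.add_assoc, D.advance_iterate_arc m (k + 1),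
      Function.iterate_succ_apply', advance, D.arc_arc, through_isLeft]
    exact hn' k (by omega)
  have h3 : n ≤ D.mateTime h := by
    by_contra hlt
    have := h2 _ (not_le.1 hlt)
    rw [← D.inl_mate] at this
    simp at this
  obtain ⟨k, hk⟩ := Nat.exists_eq_add_of_le' h3
  refine ⟨k, ?_, fun m hm => ?_⟩
  · rw [D.inl_mate, hk, Function.iterate_add_apply, h1]
  · rw [← h1, ← Function.iterate_add_apply]
    exact D.isLeft_of_lt (by omega)

/-- Arriving at the opposite end of a virtual crossing means travelling the same edge the other way.
-/
lemma Reaches.through_of_isRight [Finite X] [Finite Y] {e : (X ⊕ Y) × Fin 4} {h : X × Fin 4}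
    (hr : D.Reaches e h) (he : e.1.isLeft = false) : D.Reaches (through e) (D.mate h) := by
  have : D.Reaches (D.arc (through e)) h := by
    obtain ⟨n, hn, hn'⟩ := hr
    cases n with
    | zero =>
      rw [Function.iterate_zero, id] at hn
      simp [hn] at he
    | succ n => exact ⟨n, hn, fun m hm => hn' (m + 1) (by omega)⟩
  simpa only [D.arc_arc] using this.arc

lemma exists_reaches_of_linked [Finite X] [Finite Y] {e e' : (X ⊕ Y) × Fin 4}
    (h : e' = D.arc e ∨ e' = (e.1, e.2 + 2)) (hr : ∃ h, D.Reaches e h) :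
    ∃ h, D.Reaches e' h := by
  obtain ⟨k, hk⟩ := hr
  rcases h with rfl | rfl
  · exact ⟨_, hk.arc⟩
  · obtain ⟨x | y, p⟩ := e
    · exact ⟨_, reaches_inl (x, p + 2)⟩
    · exact ⟨_, hk.through_of_isRight rfl⟩

lemma exists_reaches_iff [Finite X] [Finite Y] {e e' : (X ⊕ Y) × Fin 4}
    (h : e' = D.arc e ∨ e' = (e.1, e.2 + 2)) :
    (∃ h, D.Reaches e h) = ∃ h, D.Reaches e' h := by
  refine propext ⟨exists_reaches_of_linked h, exists_reaches_of_linked ?_⟩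
  rcases h with rfl | rfl
  · exact Or.inl (D.arc_arc e).symm
  · right
    have : ∀ p : Fin 4, p = p + 2 + 2 := by decide
    exact Prod.ext rfl (this e.2)

variable (D) in
/-- The link components without classical crossings. -/
abbrev VirtualComponent : Type _ :=
  {k : D.LinkComponent // ∀ e, (Quot.mk _ e : D.LinkComponent) = k → e.1.isRight}

lemma isRight_of_not_reaches [Finite X] [Finite Y] {e : (X ⊕ Y) × Fin 4}
    (h : ¬ ∃ h, D.Reaches e h) (e' : (X ⊕ Y) × Fin 4)
    (he : (Quot.mk _ e' : D.LinkComponent) = Quot.mk _ e) : e'.1.isRight := by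
  have := congrArg (Quot.lift (fun e => ∃ h, D.Reaches e h) fun _ _ => exists_reaches_iff) he
  obtain ⟨x | y, p⟩ := e'
  · exact absurd (this.mp ⟨_, reaches_inl (x, p)⟩) h
  · rfl

variable (D) in
/-- The circuit partition of the universe graph that is given by a Kauffman state. -/
noncomputable def statePartition [Finite X] [Finite Y] (T : Finset X) :
    D.universeGraph.CircuitPartition where
  tr h := (h.1, if h.1 ∈ T then smoothingB h.2 else smoothingA h.2)
  vert_tr _ := rfl
  tr_tr h := by
    have hA : ∀ p, smoothingA (smoothingA p) = p := by decide
    have hB : ∀ p, smoothingB (smoothingB p) = p := by decide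
    by_cases h1 : h.1 ∈ T <;> simp [h1, hA, hB]
  tr_ne h := by
    have hA : ∀ p, smoothingA p ≠ p := by decide
    have hB : ∀ p, smoothingB p ≠ p := by decide
    intro he
    have := congrArg Prod.snd he
    by_cases h1 : h.1 ∈ T <;> simp [h1, hA, hB] at this

variable (D) in
/-- The closed curves of a Kauffman state, except for the link components without any crossing. -/
abbrev Curve (T : Finset X) : Type _ :=
  Quot fun e e' : (X ⊕ Y) × Fin 4 => e' = D.arc e ∨ e' = stateJoin T e

variable (D) in
/-- The circuit of the universe graph that corresponds to the curve of the end `e`, or the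
component of the link that coincides with that curve. -/
noncomputable def curveOf [Finite X] [Finite Y] (T : Finset X) (e : (X ⊕ Y) × Fin 4) :
    (D.statePartition T).Circuit ⊕ D.VirtualComponent :=
  if h : ∃ h, D.Reaches e h then Sum.inl (Quot.mk _ h.choose)
  else Sum.inr ⟨Quot.mk _ e, isRight_of_not_reaches h⟩

lemma curveOf_of_reaches [Finite X] [Finite Y] {T : Finset X} {e : (X ⊕ Y) × Fin 4}
    {h : X × Fin 4} (hr : D.Reaches e h) : D.curveOf T e = Sum.inl (Quot.mk _ h) := by
  have hex : ∃ h, D.Reaches e h := ⟨h, hr⟩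
  rw [curveOf, dif_pos hex, hex.choose_spec.unique hr]
  rfl

/-- Moving along an edge only replaces the reached half-edge by its `mate`, in the same circuit. A
curve that meets no classical crossing follows the link. -/
lemma curveOf_eq [Finite X] [Finite Y] {T : Finset X} (e e' : (X ⊕ Y) × Fin 4)
    (h : e' = D.arc e ∨ e' = stateJoin T e) : D.curveOf T e = D.curveOf T e' := by
  by_cases hr : ∃ h, D.Reaches e h
  · obtain ⟨k, hk⟩ := hr
    have hmate : (Quot.mk _ k : (D.statePartition T).Circuit) = Quot.mk _ (D.mate k) :=
      Quot.sound (Or.inl rfl)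
    rcases h with rfl | rfl
    · rw [curveOf_of_reaches hk, curveOf_of_reaches hk.arc, hmate]
    · obtain ⟨x | y, p⟩ := e
      · rw [curveOf_of_reaches (reaches_inl (x, p)), stateJoin,
          curveOf_of_reaches (reaches_inl (x, if x ∈ T then smoothingB p else smoothingA p))]
        exact congrArg Sum.inl (Quot.sound (Or.inr rfl))
      · rw [curveOf_of_reaches hk, hmate]
        exact (curveOf_of_reaches (hk.through_of_isRight rfl)).symm
  · have hlink : e' = D.arc e ∨ e' = (e.1, e.2 + 2) := by
      rcases h with h | h
      · exact Or.inl h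
      · obtain ⟨x | y, p⟩ := e
        · exact absurd ⟨_, reaches_inl (x, p)⟩ hr
        · exact Or.inr h
    have hr' : ¬ ∃ h, D.Reaches e' h := by rwa [← exists_reaches_iff hlink]
    rw [curveOf, curveOf, dif_neg hr, dif_neg hr']
    exact congrArg Sum.inr (Subtype.ext (Quot.sound hlink))

lemma Reaches.curve_eq [Finite X] [Finite Y] {T : Finset X} {e : (X ⊕ Y) × Fin 4}
    {h : X × Fin 4} (hr : D.Reaches e h) :
    (Quot.mk _ e : D.Curve T) = Quot.mk _ (Sum.inl h.1, h.2) := by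
  obtain ⟨n, hn, hn'⟩ := hr
  rw [← hn]
  clear hn
  induction n with
  | zero => rfl
  | succ n ih =>
    rw [ih fun m hm => hn' m (by omega), Function.iterate_succ_apply']
    have h1 := hn' n (by omega)
    generalize D.advance^[n] e = e' at h1
    obtain ⟨x | y, p⟩ := e'
    · simp at h1
    · have h2 : (Quot.mk _ (Sum.inr y, p) : D.Curve T) = Quot.mk _ (Sum.inr y, p + 2) :=
        Quot.sound (Or.inr rfl)
      exact h2.trans (Quot.sound (Or.inl rfl))

lemma linkComponent_iterate_advance (n : ℕ) (e : (X ⊕ Y) × Fin 4) :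
    (Quot.mk _ (D.advance^[n] e) : D.LinkComponent) = Quot.mk _ e := by
  induction n with
  | zero => rfl
  | succ n ih =>
    rw [← ih, Function.iterate_succ_apply']
    generalize D.advance^[n] e = e'
    have h1 : (Quot.mk _ (through e') : D.LinkComponent) = Quot.mk _ e' := by
      unfold through
      split_ifs
      · rfl
      · exact (Quot.sound
          (r := fun e e' : (X ⊕ Y) × Fin 4 => e' = D.arc e ∨ e' = (e.1, e.2 + 2))
          (Or.inr rfl)).symm
    rw [← h1]
    exact (Quot.sound
      (r := fun e e' : (X ⊕ Y) × Fin 4 => e' = D.arc e ∨ e' = (e.1, e.2 + 2)) (Or.inl rfl)).symm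

variable (D) in
lemma curveOf_bijective [Finite X] [Finite Y] (T : Finset X) :
    Function.Bijective (Quot.lift (D.curveOf T) curveOf_eq : D.Curve T → _) := by
  constructor
  · intro q q'
    induction q using Quot.ind with | _ e =>
    induction q' using Quot.ind with | _ e' =>
    intro heq
    change D.curveOf T e = D.curveOf T e' at heq
    by_cases hr : ∃ h, D.Reaches e h <;> by_cases hr' : ∃ h, D.Reaches e' h
    · obtain ⟨h, hr⟩ := hr
      obtain ⟨h', hr'⟩ := hr'
      rw [curveOf_of_reaches hr, curveOf_of_reaches hr'] at heq
      rw [hr.curve_eq, hr'.curve_eq]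
      have key : ∀ h h' : X × Fin 4, (h' = D.mate h ∨ h' = (D.statePartition T).tr h) →
          (Quot.mk _ (Sum.inl h.1, h.2) : D.Curve T) = Quot.mk _ (Sum.inl h'.1, h'.2) := by
        rintro h h' (rfl | rfl)
        · have := (reaches_inl (D := D) h).arc.curve_eq (T := T)
          rw [← this]
          exact Quot.sound (Or.inl rfl)
        · exact Quot.sound (Or.inr rfl)
      exact congrArg (Quot.lift (fun h : X × Fin 4 => (Quot.mk _ (Sum.inl h.1, h.2) : D.Curve T))
        key) (Sum.inl_injective heq)
    · rw [curveOf, curveOf, dif_pos hr, dif_neg hr'] at heq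
      cases heq
    · rw [curveOf, curveOf, dif_neg hr, dif_pos hr'] at heq
      cases heq
    · rw [curveOf, curveOf, dif_neg hr, dif_neg hr'] at heq
      have heq := congrArg Subtype.val (Sum.inr_injective heq)
      -- To pass from link components back to curves, the ends that reach a classical crossing are
      -- sent to `none`; at all others link and state join the ends alike, so `g` is constant on
      -- link components.
      let g : (X ⊕ Y) × Fin 4 → Option (D.Curve T) := fun e =>
        if ∃ h, D.Reaches e h then none else some (Quot.mk _ e)
      have key : ∀ e e' : (X ⊕ Y) × Fin 4, (e' = D.arc e ∨ e' = (e.1, e.2 + 2)) →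
          g e = g e' := by
        intro e e' h
        by_cases hr : ∃ h, D.Reaches e h
        · simp only [g]
          rw [if_pos hr, if_pos (exists_reaches_of_linked h hr)]
        · have hr' : ¬ ∃ h, D.Reaches e' h := by rwa [← exists_reaches_iff h]
          simp only [g]
          rw [if_neg hr, if_neg hr']
          refine congrArg some (Quot.sound ?_)
          obtain ⟨x | y, p⟩ := e
          · exact absurd ⟨_, reaches_inl (x, p)⟩ hr
          · exact h
      have := congrArg (Quot.lift g key) heq
      change g e = g e' at this
      simp only [g] at this
      rw [if_neg hr, if_neg hr'] at this
      exact Option.some_injective _ this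
  · rintro (q | ⟨q, hq⟩)
    · induction q using Quot.ind with | _ h =>
      exact ⟨Quot.mk _ (Sum.inl h.1, h.2), curveOf_of_reaches (reaches_inl h)⟩
    · induction q using Quot.ind with | _ e =>
      refine ⟨Quot.mk _ e, ?_⟩
      change D.curveOf T e = _
      have hr : ¬ ∃ h, D.Reaches e h := by
        rintro ⟨h, n, hn, -⟩
        simpa [hn] using hq _ (linkComponent_iterate_advance n e)
      rw [curveOf, dif_neg hr]

variable (D) in
lemma numCurves_eq [Finite X] [Finite Y] (T : Finset X) :
    D.numCurves T = Nat.card (D.statePartition T).Circuit + D.universeGraph.freeLoops := by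
  have : Finite D.LinkComponent := inferInstanceAs (Finite (Quot _))
  rw [numCurves, Nat.card_congr (Equiv.ofBijective _ (D.curveOf_bijective T)), Nat.card_sum]
  simp only [universeGraph]
  ring

/-! ### The marks -/

/-- The mark of a crossing where the Euler system follows the transition `σ` and an orientation of
its circuit leaves along the ends with `o p = true`; the crossing is positive iff `pos`. -/
def localMark (σ : Fin 4 → Fin 4) (o : Fin 4 → Bool) (pos : Bool) : VertexMark :=
  if σ = straight then
    { letter := MarkLetter.none
      hasR := decide (¬ ∀ p, o p ≠ o ((if pos then smoothingA else smoothingB) p)) }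
  else if ∀ p, o p ≠ o (straight p) then
    { letter := MarkLetter.c, hasR := decide (¬ σ = if pos then smoothingA else smoothingB) }
  else
    { letter := MarkLetter.u, hasR := decide (σ = if pos then smoothingA else smoothingB) }

/-- The diagonal entry of `𝒜(G) + Δ_T` at a crossing with mark `m`, which is in `T` iff `t`. -/
def localEntry (m : VertexMark) (pos t : Bool) : ZMod 2 :=
  (if pos then 0 else 1) +
    if t then (if m.hasR then 0 else 1) else (if m.hasR then 1 else 0)

/-- Whether a row with mark letter `l` and diagonal entry `a` is removed. -/
def localRemoved (l : MarkLetter) (a : ZMod 2) : Bool :=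
  match l with
  | MarkLetter.none => false
  | MarkLetter.c => decide (a = 0)
  | MarkLetter.u => decide (a = 1)

lemma eq_straight_or_smoothing (σ : Fin 4 → Fin 4) (h1 : ∀ p, σ (σ p) = p)
    (h2 : ∀ p, σ p ≠ p) : σ = straight ∨ σ = smoothingA ∨ σ = smoothingB := by
  have key : ∀ a b c d : Fin 4, (∀ p, ![a, b, c, d] (![a, b, c, d] p) = p) →
      (∀ p, ![a, b, c, d] p ≠ p) → (a = 2 ∧ b = 3 ∧ c = 0 ∧ d = 1) ∨
      (a = 1 ∧ b = 0 ∧ c = 3 ∧ d = 2) ∨ (a = 3 ∧ b = 2 ∧ c = 1 ∧ d = 0) := by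
    decide
  obtain ⟨a, b, c, d, rfl⟩ : ∃ a b c d, σ = ![a, b, c, d] :=
    ⟨σ 0, σ 1, σ 2, σ 3, by funext i; fin_cases i <;> rfl⟩
  rcases key a b c d h1 h2 with ⟨rfl, rfl, rfl, rfl⟩ | ⟨rfl, rfl, rfl, rfl⟩ | ⟨rfl, rfl, rfl, rfl⟩
  · exact Or.inl (by decide)
  · exact Or.inr (Or.inl rfl)
  · exact Or.inr (Or.inr rfl)

/-- This is where the table of marks enters: rows are removed where the state follows `C`, and a
remaining diagonal entry is `1` iff the smoothing is inconsistent. Testing one end `p` suffices, as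
distinct pairings of four ends differ at every end. Since `o` alternates along `σ`, only two of its
values are free. -/
lemma localRemoved_spec {σ : Fin 4 → Fin 4} (h1 : ∀ p, σ (σ p) = p) (h2 : ∀ p, σ p ≠ p)
    (o : Fin 4 → Bool) (ho : ∀ p, o (σ p) = !o p) (pos t : Bool) (p : Fin 4) :
    (localRemoved (localMark σ o pos).letter (localEntry (localMark σ o pos) pos t) = true ↔
      (if t then smoothingB p else smoothingA p) = σ p) ∧
    (¬ localRemoved (localMark σ o pos).letter (localEntry (localMark σ o pos) pos t) = true →
      (localEntry (localMark σ o pos) pos t = 1 ↔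
        o p = o (if t then smoothingB p else smoothingA p))) := by
  obtain ⟨a, b, c, d, rfl⟩ : ∃ a b c d, o = ![a, b, c, d] :=
    ⟨o 0, o 1, o 2, o 3, by funext i; fin_cases i <;> rfl⟩
  revert p
  rcases eq_straight_or_smoothing σ h1 h2 with rfl | rfl | rfl
  · obtain rfl : c = !a := ho 0
    obtain rfl : d = !b := ho 1
    revert a b pos t
    decide
  · obtain rfl : b = !a := ho 0
    obtain rfl : d = !c := ho 2
    revert a c pos t
    decide
  · obtain rfl : d = !a := ho 0
    obtain rfl : c = !b := ho 1
    revert a b pos t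
    decide

variable (D) in
-- The end `0` is always incoming, so it is paired with whichever of `1` and `3` is outgoing, and
-- this is the sign of the crossing.
lemma orientedSmoothing_eq (x : X) :
    D.orientedSmoothing x = if D.out (Sum.inl x, 1) then smoothingA else smoothingB := by
  have h0 := D.out_under x
  have h2 : D.out (Sum.inl x, 2) = true := by
    have := D.out_opposite (Sum.inl x) 0
    rwa [h0] at this
  have h3 : D.out (Sum.inl x, 3) = !D.out (Sum.inl x, 1) := D.out_opposite (Sum.inl x) 1
  have e1 : (1 : Fin 4) + 1 = 2 := rfl
  have e2 : (2 : Fin 4) + 1 = 3 := rfl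
  have e3 : (3 : Fin 4) + 1 = 0 := rfl
  have f1 : (1 : Fin 4) + 3 = 0 := rfl
  have f2 : (2 : Fin 4) + 3 = 1 := rfl
  have f3 : (3 : Fin 4) + 3 = 2 := rfl
  funext p
  cases h1 : D.out (Sum.inl x, 1) <;> rw [h1] at h3 <;> fin_cases p <;>
    simp [orientedSmoothing, smoothingA, smoothingB, h0, h1, h2, h3, e1, e2, e3, f1, f2, f3]

/-! ### Reduction of the marks and matrix entries to data at one crossing -/

section

variable [Finite X] [Finite Y] (C : D.universeGraph.EulerSystem)

/-- The transition of the Euler system at a crossing. -/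
def localTransition (x : X) (p : Fin 4) : Fin 4 := (C.tr (x, p)).2

/-- The ends of a crossing along which an orientation of the Euler circuit leaves. -/
noncomputable def localDirection (x : X) (p : Fin 4) : Bool :=
  decide (C.SameDirection (x, 0) (x, p))

lemma tr_eq (x : X) (p : Fin 4) : C.tr (x, p) = (x, localTransition C x p) :=
  Prod.ext (C.vert_tr (x, p)) rfl

lemma localTransition_involutive (x : X) (p : Fin 4) :
    localTransition C x (localTransition C x p) = p := by
  have := C.tr_tr (x, p)
  rw [tr_eq C x p, tr_eq C x] at this
  exact congrArg Prod.snd this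

lemma localTransition_ne (x : X) (p : Fin 4) : localTransition C x p ≠ p := by
  intro h
  apply C.tr_ne (x, p)
  rw [tr_eq, h]

lemma not_sameDirection_iff (x : X) (p q : Fin 4) :
    ¬ C.SameDirection (x, p) (x, q) ↔ C.SameDirection (x, p) (C.tr (x, q)) :=
  FourRegularGraph.EulerSystem.not_sameDirection_iff rfl

lemma localDirection_localTransition (x : X) (p : Fin 4) :
    localDirection C x (localTransition C x p) = !localDirection C x p := by
  rw [localDirection, localDirection, ← decide_not, ← tr_eq]
  exact decide_eq_decide.2 (not_sameDirection_iff C x 0 p).symm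

/-- A circuit has only two directions, so comparing both ends with the end `0` is enough. -/
lemma sameDirection_iff (x : X) (p q : Fin 4) :
    C.SameDirection (x, p) (x, q) ↔ localDirection C x p = localDirection C x q := by
  rw [localDirection, localDirection, decide_eq_decide]
  constructor
  · exact fun h => ⟨fun h' => h'.trans h, fun h' => h'.trans h.symm⟩
  · intro h
    by_cases hp : C.SameDirection (x, 0) (x, p)
    · exact hp.symm.trans (h.1 hp)
    · have hq := (not_sameDirection_iff C x 0 q).1 (mt h.2 hp)
      by_contra hpq
      rw [not_sameDirection_iff] at hpq
      exact hp (hq.trans hpq.symm)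

lemma follows_iff (x : X) (f : Fin 4 → Fin 4) : Follows C x f ↔ localTransition C x = f := by
  simp only [Follows, tr_eq, Prod.mk.injEq, true_and, funext_iff]

lemma consistent_iff (x : X) (f : Fin 4 → Fin 4) :
    Consistent C x f ↔ ∀ p, localDirection C x p ≠ localDirection C x (f p) := by
  simp only [Consistent, sameDirection_iff, Ne]

lemma crossingMark_eq (x : X) : crossingMark C x =
    localMark (localTransition C x) (localDirection C x) (D.out (Sum.inl x, 1)) := by
  simp only [crossingMark, localMark, follows_iff, consistent_iff, orientedSmoothing_eq]

lemma entry_eq (T : Finset X) (x : X) :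
    ((D.markedInterlacementGraph C).adjMatrix + (D.markedInterlacementGraph C).deltaMatrix T) x x =
      localEntry (crossingMark C x) (D.out (Sum.inl x, 1)) (decide (x ∈ T)) := by
  simp only [Matrix.add_apply, MarkedGraph.adjMatrix, MarkedGraph.deltaMatrix,
    Matrix.diagonal_apply_eq, localEntry, markedInterlacementGraph, Positive]
  by_cases h : D.out (Sum.inl x, 1) = true <;> by_cases hT : x ∈ T <;>
    by_cases hm : (crossingMark C x).hasR = true <;> simp [h, hT, hm]

lemma removed_iff (T : Finset X) (x : X) : (D.markedInterlacementGraph C).Removed T x ↔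
    localRemoved (crossingMark C x).letter
      (localEntry (crossingMark C x) (D.out (Sum.inl x, 1)) (decide (x ∈ T))) = true := by
  rw [MarkedGraph.Removed, entry_eq,
    show (D.markedInterlacementGraph C).mark x = crossingMark C x from rfl]
  generalize localEntry _ _ _ = a
  cases (crossingMark C x).letter <;> simp [localRemoved]

end

/-! ### The circuit-nullity formula for states, and the bracket -/

lemma card_circuit_statePartition [Fintype X] [Finite Y] (C : D.universeGraph.EulerSystem)
    (T : Finset X) : Nat.card (D.statePartition T).Circuit =
      (D.markedInterlacementGraph C).nullity T + Nat.card D.universeGraph.Component := by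
  have spec := fun x p => localRemoved_spec (localTransition_involutive C x)
    (localTransition_ne C x) _ (localDirection_localTransition C x) (D.out (Sum.inl x, 1))
    (decide (x ∈ T)) p
  refine (FourRegularGraph.card_circuit_eq C (D.statePartition T)
    ((D.markedInterlacementGraph C).Removed T)
    ((D.markedInterlacementGraph C).adjMatrix + (D.markedInterlacementGraph C).deltaMatrix T)
    ?_ ?_ ?_).trans ?_
  · intro v w hvw
    rw [Matrix.add_apply, MarkedGraph.deltaMatrix, Matrix.diagonal_apply_ne _ hvw, add_zero,
      MarkedGraph.adjMatrix, if_neg hvw]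
    rfl
  · rintro ⟨x, p⟩
    change (D.markedInterlacementGraph C).Removed T x ↔ _
    rw [removed_iff, crossingMark_eq, (spec x p).1, tr_eq]
    simp [statePartition]
  · rintro ⟨x, p⟩ h
    change ¬ (D.markedInterlacementGraph C).Removed T x at h
    change (_ + _ : Matrix X X (ZMod 2)) x x = 1 ↔ _
    rw [removed_iff, crossingMark_eq] at h
    rw [entry_eq, crossingMark_eq, (spec x p).2 h]
    simp [statePartition, sameDirection_iff]
  · rfl

end VirtualLinkDiagram

theorem mainTheorem3 {X Y : Type*} [Fintype X] [Fintype Y] (D : VirtualLinkDiagram X Y)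
    (C : D.universeGraph.EulerSystem) :
    (D.markedInterlacementGraph C).bracket = D.kauffmanBracket := by
  have h0 : ∀ T, D.numCurves T = (D.markedInterlacementGraph C).nullity T +
      D.universeGraph.numComponents := by
    intro T
    rw [D.numCurves_eq, VirtualLinkDiagram.card_circuit_statePartition C,
      FourRegularGraph.numComponents, add_assoc]
  have hexp : ∀ T, D.numCurves T - 1 = (D.universeGraph.numComponents - 1) +
      (D.markedInterlacementGraph C).nullity T := by
    intro T
    rw [h0]
    -- Subtraction is truncated. With no components there are no crossings, the matrix is empty, and
    -- both exponents are `0`.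
    rcases Nat.eq_zero_or_pos D.universeGraph.numComponents with hc | hc
    · have hX : IsEmpty X := by
        by_contra hX
        rw [not_isEmpty_iff] at hX
        have : Nonempty D.universeGraph.Component := ⟨Quot.mk _ hX.some⟩
        have := Nat.card_pos (α := D.universeGraph.Component)
        rw [FourRegularGraph.numComponents] at hc
        omega
      have : (D.markedInterlacementGraph C).nullity T = 0 :=
        Module.finrank_zero_of_subsingleton
      omega
    · omega
  rw [MarkedGraph.bracket, VirtualLinkDiagram.kauffmanBracket, Finset.mul_sum]
  refine Finset.sum_congr rfl fun T _ => ?_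
  rw [hexp, pow_add]
  change Bracket.d ^ (D.universeGraph.numComponents - 1) * _ = _
  ring
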